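/- Let $L$ be the first-order language whose only non-logical symbols are unary function symbols $f_1,\ldots,f_n$, and let $V$ be a variety in $L$: the class of models of a set $T$ of sentences of the form $(\forall \bar x)\, t(\bar x)=t'(\bar x)$. Assume that $V$ is \emph{generalized bijective}, i.e. for every $i$, $T\vdash(\forall x,y)(f_i(x)=f_i(y)\rightarrow x=y)$ and $T\vdash(\forall y)(\exists x)\,f_i(x)=y$, and \emph{commutative}, i.e. $T\vdash(\forall x)\,f_i(f_j(x))=f_j(f_i(x))$ for all $i,j$. For a tuple of generators $\bar a=(a_1,\ldots,a_m)$ and a set $R$ of identities between terms in $\bar a$, let $\langle\bar a\mid R\rangle$ be the structure generated by $\bar a$ in which the identities $t(\bar a)=t'(\bar a)$ that hold are exactly those that follow logically from $T\cup R$; let $F_m=\langle a_1,\ldots,a_m\mid\emptyset\rangle$ be the free structure on $m$ generators. Assume that $F_1$ is infinite, and let $m\ge 1$. Consider presentations with the fixed generators $a_1,\ldots,a_m$ and a single identity $t(a_i)=t'(a_j)$, where $1\le i,j\le m$ and $t,t'$ are terms built from $f_1,\ldots,f_n$; identities are counted as ordered pairs of terms, and the length of an identity is the total number of occurrences of function symbols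 in its two sides. Let $P_s$ be the number of these presentations whose identity has length at most $s$, and for an $L$-sentence $\varphi$ (without constants for the generators) let $P_s(\varphi)$ be the number of those among them for which the resulting structure satisfies $\varphi$. Then every $L$-sentence $\varphi$ that is true in $F_m$ has limiting density $1$, that is, $$\lim_{s\to\infty}\frac{P_s(\varphi)}{P_s}=1 .$$ Moreover, $F_m$ and $F_1$ are elementarily equivalent. -/

import Mathlib

open FirstOrder FirstOrder.Language

namespace UnaryVariety

/-- The function symbols `f₁, …, fₙ`, all of arity one. -/
inductive UnaryFunctions (n : ℕ) : ℕ → Type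
  | symb : Fin n → UnaryFunctions n 1

/-- The first-order language with exactly the unary function symbols `f₁, …, fₙ`. -/
def unaryLang (n : ℕ) : FirstOrder.Language.{0, 0} where
  Functions := UnaryFunctions n
  Relations := fun _ => Empty

/-- The `i`-th function symbol. -/
def fn {n : ℕ} (i : Fin n) : (unaryLang n).Functions 1 := UnaryFunctions.symb i

/-- The term `f_i(t)`. -/
def ap {n : ℕ} {α : Type} (i : Fin n) (t : (unaryLang n).Term α) : (unaryLang n).Term α :=
  (fn i).apply₁ t

/-- `T` is a set of sentences of the form `(∀ x₁ … x_k) t = t'`; its class of models is then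
an algebraic variety (equational class). -/
def IsEquational {n : ℕ} (T : (unaryLang n).Theory) : Prop :=
  ∀ φ ∈ T, ∃ (k : ℕ) (t t' : (unaryLang n).Term (Empty ⊕ Fin k)), φ = (t =' t').alls

/-- The axioms imply that every `f_i` is injective and surjective. -/
def IsGeneralizedBijective {n : ℕ} (T : (unaryLang n).Theory) : Prop :=
  ∀ i : Fin n,
    (T ⊨ᵇ (∀' ∀' ((ap i (&0) =' ap i (&1)) ⟹ ((&0) =' (&1))) : (unaryLang n).Sentence)) ∧
    (T ⊨ᵇ (∀' ∃' (ap i (&1) =' (&0)) : (unaryLang n).Sentence))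

/-- The axioms imply that the `f_i` commute. -/
def IsCommutative {n : ℕ} (T : (unaryLang n).Theory) : Prop :=
  ∀ i j : Fin n,
    T ⊨ᵇ (∀' (ap i (ap j (&0)) =' ap j (ap i (&0))) : (unaryLang n).Sentence)

/-- An identity `t(a_i) = t'(a_j)` on generators `a_1, …, a_m`, as the ordered pair of its sides,
which are terms in the generators. -/
abbrev Identity (n m : ℕ) : Type :=
  (unaryLang n).Term (Fin m) × (unaryLang n).Term (Fin m)

/-- The number of occurrences of function symbols in a term. -/
def termLength {n : ℕ} {α : Type} : (unaryLang n).Term α → ℕ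
  | .var _ => 0
  | .func _ ts => 1 + ∑ i, termLength (ts i)

/-- The length of an identity: the number of occurrences of function symbols on both sides. -/
def Identity.length {n m : ℕ} (p : Identity n m) : ℕ :=
  termLength p.1 + termLength p.2

/-- The identity `t(ā) = t'(ā)` follows logically from the axioms `T` and the identities `R`. -/
def Follows {n m : ℕ} (T : (unaryLang n).Theory) (R : Set (Identity n m))
    (t t' : (unaryLang n).Term (Fin m)) : Prop :=
  ∀ (M : Type) [(unaryLang n).Structure M] [M ⊨ T] (a : Fin m → M),
    (∀ p ∈ R, p.1.realize a = p.2.realize a) → t.realize a = t'.realize a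

/-- Two terms in the generators are identified when their equality follows from `T` and `R`. -/
def followsSetoid {n m : ℕ} (T : (unaryLang n).Theory) (R : Set (Identity n m)) :
    Setoid ((unaryLang n).Term (Fin m)) where
  r := Follows T R
  iseqv :=
    { refl := fun _ _ _ _ _ _ => rfl
      symm := fun h M _ _ a ha => (h M a ha).symm
      trans := fun h h' M _ _ a ha => (h M a ha).trans (h' M a ha) }

/-- The structure on terms: function symbols act by forming terms. -/
abbrev termStructure (n m : ℕ) : (unaryLang n).Structure ((unaryLang n).Term (Fin m)) where
  funMap := fun f ts => .func f ts
  RelMap := fun r _ => r.elim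

instance {n m : ℕ} (T : (unaryLang n).Theory) (R : Set (Identity n m)) :
    (unaryLang n).Prestructure (followsSetoid T R) where
  toStructure := termStructure n m
  fun_equiv := by
    intro k f x y h M _ _ a ha
    change Term.realize a (.func f x) = Term.realize a (.func f y)
    simp only [Term.realize]
    congr 1
    funext i
    exact h i M a ha
  rel_equiv := fun {_} {r} _ _ _ => r.elim

/-- The structure `⟨ā | R⟩` in the variety axiomatized by `T`: terms in the generators, modulo the
identities that follow from `T` and `R`. -/
abbrev Presented {n m : ℕ} (T : (unaryLang n).Theory) (R : Set (Identity n m)) : Type :=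
  Quotient (followsSetoid T R)

/-- The free structure on `m` generators. -/
abbrev Free {n : ℕ} (T : (unaryLang n).Theory) (m : ℕ) : Type :=
  Presented (m := m) T ∅

/-- The single identities on `m` generators of length at most `s`. -/
def identitiesUpTo (n m s : ℕ) : Set (Identity n m) :=
  {p | p.length ≤ s}

theorem finite_termLength_le (n m s : ℕ) :
    {t : (unaryLang n).Term (Fin m) | termLength t ≤ s}.Finite := by
  induction s with
  | zero =>
    refine (Set.finite_range (Term.var : Fin m → (unaryLang n).Term (Fin m))).subset ?_
    rintro (a | ⟨f, ts⟩) h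
    · exact ⟨a, rfl⟩
    · simp [termLength] at h
  | succ s ih =>
    refine ((Set.finite_range (Term.var : Fin m → (unaryLang n).Term (Fin m))).union
      (Set.Finite.image2 (fun i t => ap i t) (Set.finite_univ (α := Fin n)) ih)).subset ?_
    rintro (a | ⟨⟨i⟩, ts⟩) h
    · exact Or.inl ⟨a, rfl⟩
    · refine Or.inr ⟨i, trivial, ts 0, ?_, ?_⟩
      · simp [termLength] at h ⊢
        omega
      · simp only [ap, Functions.apply₁, fn]
        congr 1
        funext j
        rw [Subsingleton.elim j 0]
        rfl

/-- So the cardinalities in the definition of limiting density are those of finite sets. -/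
theorem finite_identitiesUpTo (n m s : ℕ) : (identitiesUpTo n m s).Finite := by
  refine ((finite_termLength_le n m s).prod (finite_termLength_le n m s)).subset ?_
  intro p hp
  have : termLength p.1 + termLength p.2 ≤ s := hp
  exact ⟨by simp only [Set.mem_ofPred_eq]; omega, by simp only [Set.mem_ofPred_eq]; omega⟩

/-- `P_s`, the number of presentations with `m` generators and a single identity, of length at
most `s`. -/
noncomputable def numPresentations (n m s : ℕ) : ℕ :=
  (identitiesUpTo n m s).ncard

/-- `P_s(φ)`, the number of these presentations for which the resulting structure satisfies the
sentence `φ`. -/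
noncomputable def numPresentationsSat {n : ℕ} (T : (unaryLang n).Theory) (m : ℕ)
    (φ : (unaryLang n).Sentence) (s : ℕ) : ℕ :=
  {p ∈ identitiesUpTo n m s | Presented T {p} ⊨ φ}.ncard

/-- `φ` has limiting density `d`: `P_s(φ) / P_s` tends to `d`. -/
def HasLimitingDensity {n : ℕ} (T : (unaryLang n).Theory) (m : ℕ)
    (φ : (unaryLang n).Sentence) (d : ℝ) : Prop :=
  Filter.Tendsto
    (fun s : ℕ => (numPresentationsSat T m φ s : ℝ) / (numPresentations n m s : ℝ))
    Filter.atTop (nhds d)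

end UnaryVariety

open UnaryVariety

/-! Words in the function symbols modulo provable equality form a finitely generated commutative
group `G`. It is infinite because `F₁` is, and the models of `T` are exactly the `G`-sets, `F_m`
being a free one.

The nonempty free `G`-sets satisfy a complete theory: they are infinite, and those of cardinality ℵ₁
are determined by their number of orbits, so the Łoś–Vaught test applies (`isComplete`). This gives
`F_m ≡ F_1`. By compactness, a sentence true in `F_m` holds in every nonempty model in which
finitely many nontrivial elements `e` of `G` have no fixed point (`exists_finite_words`).

In the structure presented by `u(a_i) = v(a_j)`, such an `e` can have a fixed point only if `i = j`
and `e` is a power of `u⁻¹v` (`eq_and_mem_zpowers`). A nontrivial element of a finitely generated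
commutative group has only finitely many roots, so the exceptional identities have `u⁻¹v` in a
finite set `B`.

Such identities are rare: the proportion of words of length `k` with a prescribed product tends to 0
uniformly in the product (`exists_numWords_le`), because `G` is infinite. With one side and the
length of the other fixed, only a small fraction of long choices is exceptional; identities with two
short sides are bounded in number. -/

namespace UnaryVariety

/-! ### Terms as words applied to a variable -/

section Words

variable {n : ℕ} {M : Type} [(unaryLang n).Structure M]

/-- The action of a word in the function symbols on a structure. -/
def act (w : List (Fin n)) (x : M) : M :=
  w.foldr (fun i y => Structure.funMap (fn i) ![y]) x

@[simp] theorem act_nil (x : M) : act ([] : List (Fin n)) x = x := rfl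

theorem act_cons (i : Fin n) (w : List (Fin n)) (x : M) :
    act (i :: w) x = Structure.funMap (fn i) ![act w x] := rfl

theorem act_cons_eq_act_singleton (i : Fin n) (w : List (Fin n)) (x : M) :
    act (i :: w) x = act [i] (act w x) := rfl

theorem act_append (u v : List (Fin n)) (x : M) : act (u ++ v) x = act u (act v x) := by
  simp [act]

theorem act_singleton (i : Fin n) (x : M) : act [i] x = Structure.funMap (fn i) ![x] := rfl

/-- The term obtained by applying a word to a term. -/
def wordTerm {α : Type} (w : List (Fin n)) (t : (unaryLang n).Term α) : (unaryLang n).Term α :=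
  w.foldr ap t

theorem wordTerm_cons {α : Type} (i : Fin n) (w : List (Fin n)) (t : (unaryLang n).Term α) :
    wordTerm (i :: w) t = ap i (wordTerm w t) := rfl

theorem realize_ap {α : Type} (i : Fin n) (t : (unaryLang n).Term α) (v : α → M) :
    (ap i t).realize v = act [i] (t.realize v) := by
  simp [ap, act_singleton, Term.realize_functions_apply₁]

theorem realize_wordTerm {α : Type} (w : List (Fin n)) (t : (unaryLang n).Term α) (v : α → M) :
    (wordTerm w t).realize v = act w (t.realize v) := by
  induction w with
  | nil => rfl
  | cons i w ih => rw [wordTerm_cons, realize_ap, ih, act_singleton, act_cons]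

theorem func_eq_ap {α : Type} (i : Fin n) (ts : Fin 1 → (unaryLang n).Term α) :
    Term.func (L := unaryLang n) (UnaryFunctions.symb i) ts = ap i (ts 0) := by
  simp only [ap, Functions.apply₁, fn]
  congr 1
  funext j
  rw [Subsingleton.elim j 0]
  rfl

theorem exists_eq_wordTerm {α : Type} (t : (unaryLang n).Term α) :
    ∃ (w : List (Fin n)) (a : α), t = wordTerm w (.var a) := by
  induction t with
  | var a => exact ⟨[], a, rfl⟩
  | func f ts ih =>
    obtain ⟨i⟩ := f
    obtain ⟨w, a, h⟩ := ih 0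
    exact ⟨i :: w, a, by rw [wordTerm_cons, ← h, func_eq_ap]⟩

theorem termLength_ap {α : Type} (i : Fin n) (t : (unaryLang n).Term α) :
    termLength (ap i t) = termLength t + 1 := by
  simp [ap, Functions.apply₁, termLength, add_comm]

theorem termLength_wordTerm {α : Type} (w : List (Fin n)) (a : α) :
    termLength (wordTerm w (.var a : (unaryLang n).Term α)) = w.length := by
  induction w with
  | nil => rfl
  | cons i w ih => rw [wordTerm_cons, termLength_ap, ih, List.length_cons]

theorem ap_injective {α : Type} {i j : Fin n} {s t : (unaryLang n).Term α}
    (h : ap i s = ap j t) : i = j ∧ s = t := by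
  injection h with _ h₁ h₂
  exact ⟨UnaryFunctions.symb.inj h₁, by simpa using congrFun h₂ 0⟩

theorem wordTerm_injective {α : Type} {u v : List (Fin n)} {a b : α}
    (h : wordTerm u (.var a : (unaryLang n).Term α) = wordTerm v (.var b)) : u = v ∧ a = b := by
  induction u generalizing v with
  | nil =>
    cases v with
    | nil => exact ⟨rfl, Term.var.inj h⟩
    | cons j v => exact absurd h (by simp [wordTerm, ap, Functions.apply₁])
  | cons i u ih =>
    cases v with
    | nil => exact absurd h (by simp [wordTerm, ap, Functions.apply₁])
    | cons j v =>
      obtain ⟨rfl, h'⟩ := ap_injective h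
      obtain ⟨rfl, rfl⟩ := ih h'
      exact ⟨rfl, rfl⟩

end Words

/-! ### Presented structures lie in the variety -/

section Presented

variable {n m : ℕ} (T : (unaryLang n).Theory) (R : Set (Identity n m))

theorem realize_eq_alls {M : Type} [(unaryLang n).Structure M] {k : ℕ}
    (t t' : (unaryLang n).Term (Empty ⊕ Fin k)) :
    M ⊨ ((t =' t').alls : (unaryLang n).Sentence) ↔
      ∀ xs : Fin k → M, t.realize (Sum.elim default xs) = t'.realize (Sum.elim default xs) := by
  refine BoundedFormula.realize_alls.trans (forall_congr' fun xs => ?_)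
  rw [BoundedFormula.realize_bdEqual]

/-- The class of a term in the presented structure. -/
def classOf (t : (unaryLang n).Term (Fin m)) : Presented T R := Quotient.mk (followsSetoid T R) t

theorem classOf_eq_classOf {s t : (unaryLang n).Term (Fin m)} :
    classOf T R s = classOf T R t ↔ Follows T R s t :=
  Quotient.eq (r := followsSetoid T R)

theorem act_classOf (w : List (Fin n)) (t : (unaryLang n).Term (Fin m)) :
    act w (classOf T R t) = classOf T R (wordTerm w t) := by
  induction w with
  | nil => rfl
  | cons i w ih =>
    rw [act_cons, ih, wordTerm_cons]
    have := funMap_quotient_mk' (L := unaryLang n) (s := followsSetoid T R) (fn i)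
      (fun _ => wordTerm w t)
    refine Eq.trans ?_ (this.trans ?_)
    · congr 1
      funext j
      rw [Subsingleton.elim j 0]
      rfl
    · rw [← func_eq_ap i (fun _ => wordTerm w t)]
      rfl

/-- Identities are closed under substitution: an axiom evaluated at classes of terms is an identity
between terms that holds in every model. -/
theorem presented_models (hT : IsEquational T) : Presented T R ⊨ T := by
  refine ⟨fun φ hφ => ?_⟩
  obtain ⟨k, t, t', rfl⟩ := hT φ hφ
  rw [realize_eq_alls]
  intro xs
  obtain ⟨u, a, rfl⟩ := exists_eq_wordTerm t
  obtain ⟨v, b, rfl⟩ := exists_eq_wordTerm t'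
  obtain ⟨a, rfl⟩ : ∃ a', a = Sum.inr a' := by
    rcases a with a | a
    · exact a.elim
    · exact ⟨a, rfl⟩
  obtain ⟨b, rfl⟩ : ∃ b', b = Sum.inr b' := by
    rcases b with b | b
    · exact b.elim
    · exact ⟨b, rfl⟩
  have hs : ∀ c, ∃ s, xs c = classOf T R s := fun c => (Quotient.exists_rep (xs c)).imp fun _ h => h.symm
  choose s hs using hs
  simp only [realize_wordTerm, Term.realize_var, Sum.elim_inr, hs, act_classOf]
  rw [classOf_eq_classOf]
  intro M _ hM g _
  have := (realize_eq_alls _ _).1 (hM.realize_of_mem _ hφ) fun c => (s c).realize g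
  simpa [realize_wordTerm] using this

end Presented
-- The group of words modulo provable equality
section WordGroup

variable {n : ℕ} {T : (unaryLang n).Theory}

theorem IsGeneralizedBijective.surjective (h : IsGeneralizedBijective T) {M : Type}
    [(unaryLang n).Structure M] [M ⊨ T] (i : Fin n) :
    Function.Surjective (act [i] : M → M) := by
  intro y
  have : Nonempty M := ⟨y⟩
  have := (h i).2.realize_sentence M
  simp only [Sentence.Realize, Formula.Realize, BoundedFormula.realize_all,
    BoundedFormula.realize_ex, BoundedFormula.realize_bdEqual, realize_ap] at this
  obtain ⟨x, hx⟩ := this y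
  exact ⟨x, by simpa [Fin.snoc] using hx⟩

theorem IsGeneralizedBijective.injective (h : IsGeneralizedBijective T) {M : Type}
    [(unaryLang n).Structure M] [M ⊨ T] (i : Fin n) :
    Function.Injective (act [i] : M → M) := by
  intro x y hxy
  have : Nonempty M := ⟨y⟩
  have := (h i).1.realize_sentence M
  simp only [Sentence.Realize, Formula.Realize, BoundedFormula.realize_all,
    BoundedFormula.realize_imp, BoundedFormula.realize_bdEqual, realize_ap] at this
  simpa [Fin.snoc, hxy] using this x y

theorem IsCommutative.act_comm (h : IsCommutative T) {M : Type}
    [(unaryLang n).Structure M] [M ⊨ T] (i j : Fin n) (x : M) :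
    act [i] (act [j] x) = act [j] (act [i] x) := by
  have : Nonempty M := ⟨x⟩
  have := (h i j).realize_sentence M
  simp only [Sentence.Realize, Formula.Realize, BoundedFormula.realize_all,
    BoundedFormula.realize_bdEqual, realize_ap] at this
  simpa [Fin.snoc] using this x

/-- `G`, with generators `γ i`, is the group of words in the function symbols modulo provable
equality in `T`. -/
structure IsWordGroup (T : (unaryLang n).Theory) {G : Type} [CommGroup G] (γ : Fin n → G) :
    Prop where
  exists_word : ∀ g, ∃ w : List (Fin n), (w.map γ).prod = g
  prod_eq_iff : ∀ u v : List (Fin n), (u.map γ).prod = (v.map γ).prod ↔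
    ∀ (M : Type) [(unaryLang n).Structure M] [M ⊨ T] (x : M), act u x = act v x

/-- Provable equality of words. -/
def wordCon (T : (unaryLang n).Theory) : Con (FreeMonoid (Fin n)) where
  r u v := ∀ (M : Type) [(unaryLang n).Structure M] [M ⊨ T] (x : M),
    act u.toList x = act v.toList x
  iseqv :=
    { refl := fun _ _ _ _ _ => rfl
      symm := fun h M _ _ x => (h M x).symm
      trans := fun h h' M _ _ x => (h M x).trans (h' M x) }
  mul' := by
    intro u u' v v' h h' M _ _ x
    simp only [FreeMonoid.toList_mul, act_append]
    rw [h', h]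

/-- In `F₁` the generator has a preimage under `f_i`, and this preimage is named by a word. An
equation about the generator of `F₁` is a consequence of `T`, so the same word works at every point
of every model. -/
theorem exists_right_inverse_word (hT : IsEquational T) (hbij : IsGeneralizedBijective T)
    (i : Fin n) : ∃ w : List (Fin n), ∀ (M : Type) [(unaryLang n).Structure M] [M ⊨ T] (x : M),
      act (i :: w) x = x := by
  have := presented_models T (∅ : Set (Identity n 1)) hT
  obtain ⟨y, hy⟩ := hbij.surjective i (classOf T (∅ : Set (Identity n 1)) (.var 0))
  obtain ⟨t, rfl⟩ : ∃ t, classOf T _ t = y := Quotient.exists_rep y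
  obtain ⟨w, a, rfl⟩ := exists_eq_wordTerm t
  refine ⟨w, fun M _ _ x => ?_⟩
  rw [act_classOf, classOf_eq_classOf] at hy
  have := hy M (fun _ => x) (by simp)
  simpa [realize_wordTerm, act_singleton, act_cons] using this

theorem exists_isWordGroup (hT : IsEquational T) (hbij : IsGeneralizedBijective T)
    (hcomm : IsCommutative T) :
    ∃ (G : Type) (_ : CommGroup G) (γ : Fin n → G), IsWordGroup T γ := by
  have hmul : ∀ u v : FreeMonoid (Fin n), wordCon T (u * v) (v * u) := by
    intro u v M _ _ x
    simp only [FreeMonoid.toList_mul, act_append]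
    have key : ∀ (i : Fin n) (w : List (Fin n)) (x : M),
        act [i] (act w x) = act w (act [i] x) := by
      intro i w
      induction w with
      | nil => intro x; rfl
      | cons j w ih =>
        intro x
        rw [act_cons_eq_act_singleton j, hcomm.act_comm, ih, ← act_cons_eq_act_singleton j]
    generalize u.toList = u
    induction u with
    | nil => rfl
    | cons i u ih => rw [act_cons_eq_act_singleton i, ih, key, ← act_cons_eq_act_singleton]
  let c : CommMonoid (wordCon T).Quotient :=
    { (inferInstance : Monoid (wordCon T).Quotient) with
      mul_comm := by
        intro a b
        induction a using Con.induction_on with | _ u =>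
        induction b using Con.induction_on with | _ v =>
        exact (Con.eq _).2 (hmul u v) }
  have hunit : ∀ a : (wordCon T).Quotient, IsUnit a := by
    intro a
    induction a using Con.induction_on with | _ u =>
    induction u using FreeMonoid.inductionOn' with
    | one => exact isUnit_one
    | of_mul i u ih =>
      rw [Con.coe_mul]
      refine IsUnit.mul ?_ ih
      obtain ⟨w, hw⟩ := exists_right_inverse_word hT hbij i
      refine IsUnit.of_mul_eq_one
        ((FreeMonoid.ofList w : FreeMonoid (Fin n)) : (wordCon T).Quotient) ?_
      exact (Con.eq _).2 fun M _ _ x => hw M x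
  let G : CommGroup (wordCon T).Quotient := commGroupOfIsUnit hunit
  let γ : Fin n → (wordCon T).Quotient := fun i => (FreeMonoid.of i : FreeMonoid (Fin n))
  have hprod : ∀ u : List (Fin n), (u.map γ).prod =
      ((FreeMonoid.ofList u : FreeMonoid (Fin n)) : (wordCon T).Quotient) := by
    intro u
    induction u with
    | nil => rfl
    | cons i u ih =>
      rw [List.map_cons, List.prod_cons, ih]
      rfl
  refine ⟨_, G, γ, fun g => ?_, fun u v => ?_⟩
  · induction g using Con.induction_on with | _ u =>
    exact ⟨u.toList, hprod _⟩
  · rw [hprod, hprod]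
    exact Con.eq _

end WordGroup

namespace IsWordGroup

variable {n : ℕ} {T : (unaryLang n).Theory} {G : Type} [CommGroup G] {γ : Fin n → G}

/-- A word representing a group element. -/
noncomputable def word (hγ : IsWordGroup T γ) (g : G) : List (Fin n) := (hγ.exists_word g).choose

theorem prod_word (hγ : IsWordGroup T γ) (g : G) : ((hγ.word g).map γ).prod = g :=
  (hγ.exists_word g).choose_spec

/-- Models of `T` are sets with an action of the word group. -/
@[reducible] noncomputable def mulAction (hγ : IsWordGroup T γ) (M : Type)
    [(unaryLang n).Structure M] [M ⊨ T] : MulAction G M where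
  smul g x := act (hγ.word g) x
  one_smul := (hγ.prod_eq_iff _ []).1 (by rw [hγ.prod_word]; rfl) M
  mul_smul g h x := by
    change act _ _ = act _ (act _ _)
    rw [← act_append]
    refine (hγ.prod_eq_iff _ _).1 ?_ M x
    rw [List.map_append, List.prod_append]
    simp only [hγ.prod_word]

theorem act_eq_smul (hγ : IsWordGroup T γ) {M : Type}
    [(unaryLang n).Structure M] [M ⊨ T] (w : List (Fin n)) (x : M) :
    letI := hγ.mulAction M
    act w x = (w.map γ).prod • x :=
  (hγ.prod_eq_iff _ _).1 (hγ.prod_word _).symm M x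

end IsWordGroup

/-! ### Every action of the word group is a model -/

section ActionStructure

variable {n : ℕ} {G : Type} [CommGroup G] (γ : Fin n → G) (X : Type) [MulAction G X]

/-- The structure on a set with an action of `G`, on which `f_i` acts as `γ i`. -/
abbrev actionStructure : (unaryLang n).Structure X where
  funMap := fun f xs => match f, xs with
    | .symb i, xs => γ i • xs 0
  RelMap := fun r _ => r.elim

theorem act_actionStructure (w : List (Fin n)) (x : X) :
    letI := actionStructure γ X
    act w x = (w.map γ).prod • x := by
  induction w with
  | nil => exact (one_smul G x).symm
  | cons i w ih =>
    rw [List.map_cons, List.prod_cons, mul_smul, ← ih]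
    rfl

variable {γ} {T : (unaryLang n).Theory}

theorem IsWordGroup.infinite (hγ : IsWordGroup T γ) (hinf : Infinite (Free T 1)) : Infinite G := by
  have hs : Function.Surjective fun g : G => classOf T (∅ : Set (Identity n 1))
      (wordTerm (hγ.word g) (.var 0)) := by
    intro y
    obtain ⟨t, rfl⟩ : ∃ t, classOf T _ t = y := Quotient.exists_rep y
    obtain ⟨w, a, rfl⟩ := exists_eq_wordTerm t
    refine ⟨(w.map γ).prod, ?_⟩
    rw [classOf_eq_classOf]
    intro M _ _ g _
    rw [realize_wordTerm, realize_wordTerm, Subsingleton.elim a 0]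
    exact (hγ.prod_eq_iff _ _).1 (hγ.prod_word _) M _
  exact Infinite.of_surjective _ hs

/-- An axiom `u(x) = v(y)` with `x ≠ y` would make `u` constant on `F₁`; as `u` acts injectively,
`F₁` would be a singleton. So both sides have the same variable, and the axiom says that `u` and `v`
are equal in the word group. -/
theorem IsWordGroup.actionStructure_models (hγ : IsWordGroup T γ) (hT : IsEquational T)
    (hinf : Infinite (Free T 1)) :
    letI := actionStructure γ X
    X ⊨ T := by
  let := actionStructure γ X
  refine ⟨fun φ hφ => ?_⟩
  obtain ⟨k, t, t', rfl⟩ := hT φ hφ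
  rw [realize_eq_alls]
  intro xs
  obtain ⟨u, a, rfl⟩ := exists_eq_wordTerm t
  obtain ⟨v, b, rfl⟩ := exists_eq_wordTerm t'
  obtain ⟨a, rfl⟩ : ∃ a', a = Sum.inr a' := by
    rcases a with a | a
    · exact a.elim
    · exact ⟨a, rfl⟩
  obtain ⟨b, rfl⟩ : ∃ b', b = Sum.inr b' := by
    rcases b with b | b
    · exact b.elim
    · exact ⟨b, rfl⟩
  have hM : ∀ (M : Type) [(unaryLang n).Structure M] [M ⊨ T] (ys : Fin k → M),
      act u (ys a) = act v (ys b) := by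
    intro M _ hM ys
    have := (realize_eq_alls _ _).1 (hM.realize_of_mem _ hφ) ys
    simpa [realize_wordTerm] using this
  obtain rfl : a = b := by
    by_contra hab
    have := presented_models T (∅ : Set (Identity n 1)) hT
    let := hγ.mulAction (Free T 1)
    refine not_subsingleton (Free T 1) ⟨fun x y => ?_⟩
    have h₁ := hM (Free T 1) (Function.update (fun _ => y) a x)
    have h₂ := hM (Free T 1) (fun _ => y)
    rw [Function.update_self, Function.update_of_ne (Ne.symm hab), ← h₂, hγ.act_eq_smul,
      hγ.act_eq_smul] at h₁
    exact MulAction.injective _ h₁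
  have huv : (u.map γ).prod = (v.map γ).prod :=
    (hγ.prod_eq_iff _ _).2 fun M _ _ x => hM M fun _ => x
  simp only [realize_wordTerm, Term.realize_var, Sum.elim_inr]
  rw [act_actionStructure, act_actionStructure, huv]

end ActionStructure
-- Classification of large free actions
section FreeActions

open Cardinal

variable {G X Y : Type} [Group G] [MulAction G X] [MulAction G Y]

/-- A free action is a disjoint union of copies of `G`, one for each orbit, based at chosen
representatives. -/
theorem bijective_smul_out (hX : ∀ (g : G) (x : X), g • x = x → g = 1) :
    Function.Bijective
      fun p : Quotient (MulAction.orbitRel G X) × G => p.2 • (Quotient.out p.1 : X) := by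
  constructor
  · rintro ⟨q, g⟩ ⟨r, h⟩ (hgh : g • Quotient.out q = h • Quotient.out r)
    have hq : q = r := by
      rw [← Quotient.out_eq q, ← Quotient.out_eq r]
      refine Quotient.sound ⟨g⁻¹ * h, ?_⟩
      change (g⁻¹ * h) • Quotient.out r = Quotient.out q
      rw [mul_smul, ← hgh, inv_smul_smul]
    subst hq
    have := hX (h⁻¹ * g) (Quotient.out q) (by rw [mul_smul, hgh, inv_smul_smul])
    rw [inv_mul_eq_one] at this
    rw [this]
  · intro x
    obtain ⟨g, hg⟩ := Quotient.exact
      (Quotient.out_eq (Quotient.mk (MulAction.orbitRel G X) x)).symm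
    exact ⟨(_, g), hg⟩

theorem mk_orbits_eq (hX : ∀ (g : G) (x : X), g • x = x → g = 1) (hG : #G < #X)
    (hκ : ℵ₀ ≤ #X) : #(Quotient (MulAction.orbitRel G X)) = #X := by
  refine le_antisymm mk_quotient_le (le_of_not_gt fun h => ?_)
  have := mk_congr (Equiv.ofBijective _ (bijective_smul_out hX))
  rw [mk_prod, lift_id, lift_id] at this
  exact (mul_lt_of_lt hκ h hG).ne this

/-- Two free actions of `G` on sets of the same infinite cardinality exceeding that of `G` are
isomorphic. -/
theorem exists_equivariant_equiv (hX : ∀ (g : G) (x : X), g • x = x → g = 1)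
    (hY : ∀ (g : G) (x : Y), g • x = x → g = 1) (hG : #G < #X) (hκ : ℵ₀ ≤ #X) (hXY : #X = #Y) :
    ∃ e : X ≃ Y, ∀ (g : G) (x : X), e (g • x) = g • e x := by
  have hQ : #(Quotient (MulAction.orbitRel G X)) = #(Quotient (MulAction.orbitRel G Y)) := by
    rw [mk_orbits_eq hX hG hκ, mk_orbits_eq hY (hXY ▸ hG) (hXY ▸ hκ), hXY]
  obtain ⟨q⟩ := Cardinal.eq.1 hQ
  let eX := Equiv.ofBijective _ (bijective_smul_out hX)
  let eY := Equiv.ofBijective _ (bijective_smul_out hY)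
  refine ⟨(eX.symm.trans (q.prodCongr (Equiv.refl G))).trans eY, fun g x => ?_⟩
  obtain ⟨⟨r, h⟩, rfl⟩ := eX.surjective x
  have hg : g • eX (r, h) = eX (r, g * h) := (mul_smul g h _).symm
  rw [hg]
  simp only [Equiv.trans_apply, Equiv.symm_apply_apply]
  exact mul_smul g h _

end FreeActions

/-! ### Completeness of the theory of free actions -/

section FreeTheory

open Cardinal

variable {n : ℕ} (T : (unaryLang n).Theory) {G : Type} [CommGroup G] (γ : Fin n → G)

/-- The sentence stating that a word has no fixed points. -/
def noFixedPoint (w : List (Fin n)) : (unaryLang n).Sentence :=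
  ∀' ∼(wordTerm w (&0) =' &0)

theorem realize_noFixedPoint {M : Type} [(unaryLang n).Structure M] (w : List (Fin n)) :
    M ⊨ noFixedPoint w ↔ ∀ x : M, act w x ≠ x := by
  simp [noFixedPoint, Sentence.Realize, Formula.Realize, realize_wordTerm, Fin.snoc]

/-- The words that represent a nontrivial element of the word group. -/
def nontrivialWords : Set (List (Fin n)) := {w | (w.map γ).prod ≠ 1}

/-- The theory of models of `T` on which the word group acts freely. -/
def freeTheory : (unaryLang n).Theory := T ∪ noFixedPoint '' nontrivialWords γ

variable {T γ}

theorem model_freeTheory_iff {M : Type} [(unaryLang n).Structure M] :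
    M ⊨ freeTheory T γ ↔ M ⊨ T ∧ ∀ w : List (Fin n), (w.map γ).prod ≠ 1 → ∀ x : M, act w x ≠ x := by
  rw [freeTheory, Theory.model_union_iff, Theory.model_iff (noFixedPoint '' _), Set.forall_mem_image]
  exact and_congr_right fun _ => forall₂_congr fun w _ => realize_noFixedPoint w

namespace IsWordGroup

theorem smul_eq_self (hγ : IsWordGroup T γ) {M : Type} [(unaryLang n).Structure M]
    [M ⊨ T] (hM : M ⊨ freeTheory T γ) (g : G) (x : M) :
    letI := hγ.mulAction M
    g • x = x → g = 1 := by
  intro h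
  by_contra hg
  refine (model_freeTheory_iff.1 hM).2 (hγ.word g) (by rwa [hγ.prod_word]) x ?_
  rw [hγ.act_eq_smul, hγ.prod_word, h]

theorem infinite_model (hγ : IsWordGroup T γ) [Infinite G] {M : Type} [(unaryLang n).Structure M]
    [Nonempty M] (hM : M ⊨ freeTheory T γ) : Infinite M := by
  have := (model_freeTheory_iff.1 hM).1
  let := hγ.mulAction M
  obtain ⟨x⟩ := ‹Nonempty M›
  refine Infinite.of_injective (fun g : G => g • x) fun g h (hgh : g • x = h • x) => ?_
  have := hγ.smul_eq_self hM (h⁻¹ * g) x (by rw [mul_smul, hgh, inv_smul_smul])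
  rw [inv_mul_eq_one] at this
  exact this.symm

/-- `G` is countable, so a free `G`-set of cardinality ℵ₁ has ℵ₁ orbits and is unique up to
isomorphism. -/
theorem categorical (hγ : IsWordGroup T γ) :
    Categorical.{0, 0, 0} (Order.succ ℵ₀) (freeTheory T γ) := by
  intro M N hM hN
  have hM' : M ⊨ T := (model_freeTheory_iff.1 M.is_model).1
  have hN' : N ⊨ T := (model_freeTheory_iff.1 N.is_model).1
  let := hγ.mulAction M
  let := hγ.mulAction N
  have hG : #G ≤ ℵ₀ := by
    rw [mk_le_aleph0_iff]
    have : Function.Surjective fun w : List (Fin n) => (w.map γ).prod := hγ.exists_word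
    exact this.countable
  obtain ⟨e, he⟩ := exists_equivariant_equiv (G := G) (X := M) (Y := N)
    (hγ.smul_eq_self M.is_model) (hγ.smul_eq_self N.is_model)
    (by rw [hM]; exact Order.lt_succ_of_le hG) (by rw [hM]; exact Order.le_succ _) (by rw [hM, hN])
  have hact : ∀ (i : Fin n) (x : M), e (act [i] x) = act [i] (e x) := by
    intro i x
    rw [hγ.act_eq_smul, hγ.act_eq_smul, he]
  refine ⟨⟨e, ?_, fun r => r.elim⟩⟩
  rintro _ ⟨i⟩ xs
  have hxs : ∀ {Z : Type} (ys : Fin 1 → Z), ys = ![ys 0] := fun ys => by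
    funext j
    rw [Subsingleton.elim j 0]
    rfl
  rw [hxs xs, hxs (_ ∘ ![xs 0])]
  exact hact i (xs 0)

theorem card_unaryLang_le : (unaryLang n).card ≤ ℵ₀ := by
  have : Countable (Σ l, (unaryLang n).Functions l) := by
    refine Function.Surjective.countable (f := fun i : Fin n => ⟨1, fn i⟩) ?_
    rintro ⟨_, ⟨i⟩⟩
    exact ⟨i, rfl⟩
  have : Countable (Σ l, (unaryLang n).Relations l) := ⟨fun x => x.2.elim, fun x => x.2.elim⟩
  rw [Language.card, mk_le_aleph0_iff]
  exact inferInstanceAs (Countable (_ ⊕ _))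

theorem isComplete (hγ : IsWordGroup T γ) [Infinite G] {M : Type} [(unaryLang n).Structure M]
    [Nonempty M] (hM : M ⊨ freeTheory T γ) : (freeTheory T γ).IsComplete := by
  refine Categorical.isComplete (Order.succ ℵ₀) _ hγ.categorical (Order.le_succ _) ?_
    hM.isSatisfiable fun N => hγ.infinite_model N.is_model
  rw [lift_id, lift_id]
  exact card_unaryLang_le.trans (Order.le_succ _)

/-- A sentence true in a free model is true in all models in which finitely many given nontrivial
words have no fixed points. -/
theorem exists_finite_words (hγ : IsWordGroup T γ) [Infinite G] {M : Type}
    [(unaryLang n).Structure M] [Nonempty M] (hM : M ⊨ freeTheory T γ)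
    (φ : (unaryLang n).Sentence) (hφ : M ⊨ φ) :
    ∃ E : Finset (List (Fin n)), (∀ w ∈ E, (w.map γ).prod ≠ 1) ∧
      ∀ (N : Type) [(unaryLang n).Structure N] [Nonempty N] [N ⊨ T],
        (∀ w ∈ E, ∀ x : N, act w x ≠ x) → N ⊨ φ := by
  classical
  -- By completeness, truth in `M` is entailment by the theory. Compactness leaves a finite `T₀`,
  -- whose members outside `T` are fixed-point axioms for the words of `E`.
  have hmod := ((hγ.isComplete hM).realize_sentence_iff φ M).1 hφ
  obtain ⟨T₀, hT₀, h⟩ := Theory.models_iff_finset_models.1 hmod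
  have hT₁ : ((T₀.filter (· ∉ T) : Finset _) : Set (unaryLang n).Sentence) ⊆
      noFixedPoint '' nontrivialWords γ := by
    intro ψ hψ
    simp only [Finset.coe_filter, Set.mem_ofPred_eq] at hψ
    exact (hT₀ hψ.1).resolve_left hψ.2
  obtain ⟨E, hE, hET⟩ := Finset.subset_set_image_iff.1 hT₁
  refine ⟨E, fun w hw => hE hw, fun N _ _ hN hfix => ?_⟩
  have : N ⊨ (T₀ : (unaryLang n).Theory) := by
    refine ⟨fun ψ hψ => ?_⟩
    by_cases hψT : ψ ∈ T
    · exact hN.realize_of_mem ψ hψT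
    · have : ψ ∈ T₀.filter (· ∉ T) := Finset.mem_filter.2 ⟨hψ, hψT⟩
      rw [← hET, Finset.mem_image] at this
      obtain ⟨w, hw, rfl⟩ := this
      exact (realize_noFixedPoint w).2 (hfix w hw)
  exact h.realize_sentence N

end IsWordGroup

end FreeTheory
-- Finiteness of the set of roots
section Roots

/-- In a finitely generated commutative group, a nontrivial element is a power of only finitely many
elements. -/
theorem finite_setOf_mem_zpowers {G : Type} [CommGroup G] [Group.FG G] {e : G} (he : e ≠ 1) :
    {g : G | e ∈ Subgroup.zpowers g}.Finite := by
  obtain ⟨ι, j, _, _, p, hp, a, ⟨f⟩⟩ := CommGroup.equiv_free_prod_prod_multiplicative_zmod G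
  have : ∀ i, NeZero (p i ^ a i) := fun i => ⟨pow_ne_zero _ (hp i).ne_zero⟩
  have : ∀ i, Finite (Multiplicative (ZMod (p i ^ a i))) := fun i =>
    inferInstanceAs (Finite (ZMod (p i ^ a i)))
  -- If `e = g ^ k` with `k ≠ 0`, each free coordinate of `g` divides that of `e`, and is bounded by
  -- it in absolute value; vanishing coordinates of `e` force vanishing ones of `g`. The torsion
  -- part has finitely many values anyway.
  have hfin : (Set.univ.pi fun c : j => Multiplicative.toAdd ⁻¹'
      Set.Icc (-|Multiplicative.toAdd ((f e).1 c)|) |Multiplicative.toAdd ((f e).1 c)|).Finite :=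
    Set.Finite.pi fun c =>
      (Set.finite_Icc _ _).preimage (Multiplicative.toAdd.injective.injOn)
  refine ((hfin.prod (Set.finite_univ
    (α := (i : ι) → Multiplicative (ZMod (p i ^ a i))))).preimage f.injective.injOn).subset ?_
  rintro g ⟨k, rfl⟩
  refine ⟨fun c _ => ?_, trivial⟩
  have hk : k ≠ 0 := by
    rintro rfl
    exact he (zpow_zero g)
  change Multiplicative.toAdd ((f g).1 c) ∈ Set.Icc (-|Multiplicative.toAdd ((f (g ^ k)).1 c)|)
    |Multiplicative.toAdd ((f (g ^ k)).1 c)|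
  rw [Set.mem_Icc, ← abs_le]
  have hfg : Multiplicative.toAdd ((f (g ^ k)).1 c) = k * Multiplicative.toAdd ((f g).1 c) := by
    rw [map_zpow]
    rfl
  rw [hfg, abs_mul]
  exact le_mul_of_one_le_left (abs_nonneg _) (Int.one_le_abs hk)

end Roots

/-! ### Products of long words do not concentrate -/

section Walk

/-- The sets of products of words of a fixed length are arbitrarily large. -/
theorem exists_length_products {ι G : Type} [CommGroup G] {γ : ι → G}
    (hγ : ∀ g, ∃ w : List ι, (w.map γ).prod = g) [Infinite G] (N : ℕ) :
    ∃ (l : ℕ) (A : Finset G), N ≤ A.card ∧ ∀ g ∈ A, ∃ w : Fin l → ι, ∏ j, γ (w j) = g := by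
  obtain ⟨i⟩ : Nonempty ι := by
    by_contra h
    rw [not_nonempty_iff] at h
    refine not_subsingleton G ⟨fun a b => ?_⟩
    obtain ⟨u, rfl⟩ := hγ a
    obtain ⟨v, rfl⟩ := hγ b
    rw [Subsingleton.elim u v]
  choose word hword using hγ
  -- A nonempty word with product 1, used as padding: it changes the length but not the product.
  let z := i :: word (γ i)⁻¹
  have hz : (z.map γ).prod = 1 := by simp [z, hword]
  have hz0 : 0 < z.length := by simp [z]
  have hpow : ∀ t : ℕ, ∃ y : List ι, y.length = z.length * t ∧ (y.map γ).prod = 1 := by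
    intro t
    induction t with
    | zero => exact ⟨[], rfl, rfl⟩
    | succ t ih =>
      obtain ⟨y, hy, hy'⟩ := ih
      exact ⟨z ++ y, by rw [List.length_append, hy]; ring, by simp [hz, hy']⟩
  -- Padding changes lengths by multiples of `z.length`, so infinitely many elements with one common
  -- residue are needed.
  obtain ⟨r, hr⟩ := Finite.exists_infinite_fiber
    fun g : G => (⟨(word g).length % z.length, Nat.mod_lt _ hz0⟩ : Fin z.length)
  obtain ⟨A, hA, hAN⟩ := (Set.infinite_coe_iff.1 hr).exists_subset_card_eq N
  let D := A.sup fun g => (word g).length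
  refine ⟨r + z.length * D, A, hAN.ge, fun g hg => ?_⟩
  have hgr : (word g).length % z.length = r := congrArg Fin.val (hA hg)
  have hgD : (word g).length / z.length ≤ D :=
    (Nat.div_le_self _ _).trans (Finset.le_sup (f := fun g => (word g).length) hg)
  obtain ⟨y, hy, hy'⟩ := hpow (D - (word g).length / z.length)
  have hlen : (word g ++ y).length = r + z.length * D := by
    obtain ⟨d, hd⟩ := Nat.exists_eq_add_of_le hgD
    rw [List.length_append, hy, hd, Nat.add_sub_cancel_left, mul_add, ← add_assoc, ← hgr,
      Nat.mod_add_div]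
  rw [← hlen]
  refine ⟨(word g ++ y).get, ?_⟩
  rw [← List.prod_ofFn]
  have : (List.ofFn fun j => γ ((word g ++ y).get j)) = (word g ++ y).map γ := by
    rw [← Function.comp_def, ← List.map_ofFn, List.ofFn_get]
  rw [this, List.map_append, List.prod_append, hword, hy', mul_one]

variable {ι G : Type} [Fintype ι] [CommGroup G] [DecidableEq G] (γ : ι → G)

/-- The number of words of length `k` whose product is `g`. -/
def numWords (k : ℕ) (g : G) : ℕ :=
  (Finset.univ.filter fun w : Fin k → ι => ∏ j, γ (w j) = g).card

/-- Condition on the last `l` letters. -/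
theorem numWords_add (k l : ℕ) (g : G) :
    numWords γ (k + l) g = ∑ w : Fin l → ι, numWords γ k ((∏ j, γ (w j))⁻¹ * g) := by
  classical
  have h : numWords γ (k + l) g =
      (Finset.univ.filter fun p : (Fin k → ι) × (Fin l → ι) =>
        (∏ j, γ (p.1 j)) * ∏ j, γ (p.2 j) = g).card := by
    refine (Finset.card_equiv (Fin.appendEquiv k l) fun p => ?_).symm
    simp [Fin.prod_univ_add, Fin.appendEquiv]
  rw [h, Finset.card_eq_sum_card_fiberwise (f := Prod.snd) (t := Finset.univ)
    (fun _ _ => Finset.mem_coe.2 (Finset.mem_univ _))]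
  refine Finset.sum_congr rfl fun w _ => ?_
  refine Finset.card_bij (fun p _ => p.1) ?_ ?_ ?_
  · rintro ⟨u, v⟩ h
    simp only [Finset.mem_filter, Finset.mem_univ, true_and] at h ⊢
    obtain ⟨rfl, rfl⟩ := h
    rw [mul_comm, mul_inv_cancel_right]
  · rintro ⟨u, v⟩ h ⟨u', v'⟩ h' huu
    simp only [Finset.mem_filter, Finset.mem_univ, true_and] at h h' huu
    rw [huu, h.2, h'.2]
  · intro u hu
    simp only [Finset.mem_filter, Finset.mem_univ, true_and] at hu ⊢
    exact ⟨(u, w), ⟨by rw [hu, mul_comm, mul_inv_cancel_left], rfl⟩, rfl⟩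

theorem sum_numWords_le (k : ℕ) (A : Finset G) :
    ∑ g ∈ A, numWords γ k g ≤ Fintype.card ι ^ k := by
  classical
  unfold numWords
  rw [Finset.sum_card_fiberwise_eq_card_filter]
  exact (Finset.card_filter_le _ _).trans (by simp)

variable {γ}

/-- The proportion at length `k + l` is an average of proportions at length `k`, so a uniform bound
persists. -/
theorem numWords_add_le {k : ℕ} {c : ℝ} (h : ∀ g, (numWords γ k g : ℝ) ≤ c * Fintype.card ι ^ k)
    (l : ℕ) (g : G) : (numWords γ (k + l) g : ℝ) ≤ c * Fintype.card ι ^ (k + l) := by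
  rw [numWords_add, Nat.cast_sum]
  refine (Finset.sum_le_sum fun w _ => h _).trans (le_of_eq ?_)
  rw [Finset.sum_const, Finset.card_univ, nsmul_eq_mul, Fintype.card_fun, Fintype.card_fin]
  push_cast
  ring

/-- No element of an infinite group is the product of a positive proportion of the long words. -/
theorem exists_numWords_le (hγ : ∀ g, ∃ w : List ι, (w.map γ).prod = g) [Infinite G] {ε : ℝ}
    (hε : 0 < ε) :
    ∃ K, ∀ k, K ≤ k → ∀ g, (numWords γ k g : ℝ) ≤ ε * Fintype.card ι ^ k := by
  classical
  suffices h : ∃ K, ∀ g, (numWords γ K g : ℝ) ≤ ε * Fintype.card ι ^ K by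
    obtain ⟨K, hK⟩ := h
    refine ⟨K, fun k hk g => ?_⟩
    obtain ⟨l, rfl⟩ := Nat.exists_eq_add_of_le hk
    exact numWords_add_le hK l g
  have hι : 0 < (Fintype.card ι : ℝ) := by
    obtain ⟨l, A, hA, hA'⟩ := exists_length_products hγ 2
    have : Nonempty ι := by
      by_contra h
      rw [not_nonempty_iff] at h
      obtain ⟨a, ha, b, hb, hab⟩ := Finset.one_lt_card.1 hA
      obtain ⟨u, rfl⟩ := hA' a ha
      obtain ⟨v, rfl⟩ := hA' b hb
      rw [Subsingleton.elim u v] at hab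
      exact hab rfl
    exact_mod_cast Fintype.card_pos
  -- The infimum `c` of `S` is the limit of the maximal proportions. If `c > 0`, a nearly maximal
  -- proportion at length `K + l` forces proportions of at least `c / 2` at more than `2 / c`
  -- elements for length `K`, exceeding total mass 1.
  let S : Set ℝ := {c | 0 ≤ c ∧ ∃ K, ∀ g, (numWords γ K g : ℝ) ≤ c * Fintype.card ι ^ K}
  have hSb : BddBelow S := ⟨0, fun c hc => hc.1⟩
  have hSn : S.Nonempty := by
    refine ⟨1, zero_le_one, 0, fun g => ?_⟩
    have := sum_numWords_le γ 0 {g}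
    rw [Finset.sum_singleton] at this
    rw [one_mul]
    exact_mod_cast this
  set c := sInf S with hc
  have hc0 : 0 ≤ c := le_csInf hSn fun x hx => hx.1
  by_contra hcon
  push Not at hcon
  have hcε : ε ≤ c := by
    refine le_csInf hSn fun x hx => le_of_not_gt fun hxε => ?_
    obtain ⟨-, K, hK⟩ := hx
    obtain ⟨g, hg⟩ := hcon K
    exact absurd (hg.trans_le (hK g)) (not_lt.2 (by gcongr))
  have hcpos : 0 < c := hε.trans_le hcε
  obtain ⟨N, hN⟩ := exists_nat_gt (2 / c)
  obtain ⟨l, A, hAN, hA⟩ := exists_length_products hγ N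
  set q : ℝ := (Fintype.card ι : ℝ) ^ l with hq
  have hqpos : 0 < q := pow_pos hι l
  -- Chosen so that the loss `2qδ` in the averaging below is `c / 2`.
  set δ := c / (4 * q) with hδ
  have hδpos : 0 < δ := by positivity
  have hδq : 4 * q * δ = c := by rw [hδ]; field_simp
  obtain ⟨b, ⟨hb0, K, hK⟩, hbc⟩ := exists_lt_of_csInf_lt hSn (show sInf S < c + δ by linarith)
  obtain ⟨g, hg⟩ : ∃ g, (c - δ) * Fintype.card ι ^ (K + l) < (numWords γ (K + l) g : ℝ) := by
    by_contra h
    push Not at h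
    by_cases hcδ : 0 ≤ c - δ
    · have := csInf_le hSb (show c - δ ∈ S from ⟨hcδ, K + l, h⟩)
      linarith
    · have h1 := h 1
      have : (c - δ) * (Fintype.card ι : ℝ) ^ (K + l) < 0 :=
        mul_neg_of_neg_of_pos (not_le.1 hcδ) (pow_pos hι _)
      have h2 : (0 : ℝ) ≤ numWords γ (K + l) 1 := Nat.cast_nonneg _
      linarith
  set Q : ℝ := (Fintype.card ι : ℝ) ^ K with hQ
  have hQpos : 0 < Q := pow_pos hι K
  rw [numWords_add, Nat.cast_sum, pow_add, ← hQ, ← hq] at hg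
  -- The `q` summands are at most `(c + δ)Q` each and their sum exceeds `(c - δ)qQ`, so no single
  -- one can be small.
  have hlow : ∀ w : Fin l → ι, c / 2 * Q ≤ (numWords γ K ((∏ j, γ (w j))⁻¹ * g) : ℝ) := by
    intro w
    rw [← Finset.add_sum_erase _ _ (Finset.mem_univ w)] at hg
    have hrest : ∑ v ∈ Finset.univ.erase w, (numWords γ K ((∏ j, γ (v j))⁻¹ * g) : ℝ) ≤
        (q - 1) * ((c + δ) * Q) := by
      refine (Finset.sum_le_sum fun v _ => (hK _).trans
        (mul_le_mul_of_nonneg_right hbc.le hQpos.le)).trans (le_of_eq ?_)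
      rw [Finset.sum_const, Finset.card_erase_of_mem (Finset.mem_univ _), Finset.card_univ,
        nsmul_eq_mul, Nat.cast_sub (Fintype.card_pos_iff.2 ⟨w⟩), Fintype.card_fun,
        Fintype.card_fin, hq]
      push_cast
      ring
    have : c / 2 * Q ≤ (c - δ) * (Q * q) - (q - 1) * ((c + δ) * Q) := by
      have e : (c - δ) * (Q * q) - (q - 1) * ((c + δ) * Q) =
          c * Q + δ * Q - (4 * q * δ) / 2 * Q := by ring
      rw [e, hδq]
      have : 0 < δ * Q := mul_pos hδpos hQpos
      linarith
    linarith
  have hsum := sum_numWords_le γ K (A.image fun h => h⁻¹ * g)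
  rw [Finset.sum_image (by intro x _ y _ h; simpa using h)] at hsum
  have hsum' : (∑ h ∈ A, (numWords γ K (h⁻¹ * g) : ℝ)) ≤ Q := by
    rw [hQ]
    exact_mod_cast hsum
  have hge : (A.card : ℝ) * (c / 2 * Q) ≤ ∑ h ∈ A, (numWords γ K (h⁻¹ * g) : ℝ) := by
    rw [← nsmul_eq_mul]
    refine Finset.card_nsmul_le_sum _ _ _ fun h hh => ?_
    obtain ⟨w, rfl⟩ := hA h hh
    exact hlow w
  have h1 : (2 / c) * (c / 2 * Q) < A.card * (c / 2 * Q) := by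
    have : (N : ℝ) ≤ A.card := by exact_mod_cast hAN
    exact mul_lt_mul_of_pos_right (hN.trans_le this) (by positivity)
  have h2 : (2 / c) * (c / 2 * Q) = Q := by field_simp
  linarith

end Walk
-- Fixed points in one-relator structures
section FixedPoints

variable {n m : ℕ} {T : (unaryLang n).Theory} {G : Type} [CommGroup G] {γ : Fin n → G}

namespace IsWordGroup

theorem fg (hγ : IsWordGroup T γ) : Group.FG G := by
  refine Group.fg_iff.2 ⟨Set.range γ, ?_, Set.finite_range γ⟩
  rw [eq_top_iff]
  rintro g -
  obtain ⟨w, rfl⟩ := hγ.exists_word g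
  refine Subgroup.list_prod_mem _ fun x hx => ?_
  obtain ⟨i, -, rfl⟩ := List.mem_map.1 hx
  exact Subgroup.subset_closure ⟨i, rfl⟩

/-- Any `G`-set with points satisfying `R` serves as a test structure: a fixed point in the
presented structure must map to a fixed point there. -/
theorem smul_eq_of_follows (hγ : IsWordGroup T γ) (hT : IsEquational T)
    (hinf : Infinite (Free T 1)) {R : Set (Identity n m)} {w r : List (Fin n)} {c : Fin m}
    (h : act w (classOf T R (wordTerm r (.var c))) = classOf T R (wordTerm r (.var c)))
    (X : Type) [MulAction G X] (a : Fin m → X)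
    (ha : letI := actionStructure γ X; ∀ p ∈ R, p.1.realize a = p.2.realize a) :
    (w.map γ).prod • (r.map γ).prod • a c = (r.map γ).prod • a c := by
  let := actionStructure γ X
  have := hγ.actionStructure_models X hT hinf
  rw [act_classOf, classOf_eq_classOf] at h
  have := h X a ha
  simpa only [realize_wordTerm, Term.realize_var, act_actionStructure] using this

theorem free_models (hγ : IsWordGroup T γ) (hT : IsEquational T)
    (hinf : Infinite (Free T 1)) : Free T m ⊨ freeTheory T γ := by
  refine model_freeTheory_iff.2 ⟨presented_models T _ hT, fun w hw x hx => hw ?_⟩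
  obtain ⟨t, rfl⟩ : ∃ t, classOf T _ t = x := Quotient.exists_rep x
  obtain ⟨r, c, rfl⟩ := exists_eq_wordTerm t
  simpa using hγ.smul_eq_of_follows hT hinf hx G (fun _ => 1) (by simp)

/-- In the structure presented by `u(a_i) = v(a_j)`, a nontrivial group element has a fixed point
only if `i = j` and it is a power of `u⁻¹ v`. -/
theorem eq_and_mem_zpowers (hγ : IsWordGroup T γ) (hT : IsEquational T)
    (hinf : Infinite (Free T 1)) {u v w : List (Fin n)} {i j : Fin m}
    (hw : (w.map γ).prod ≠ 1)
    (x : Presented T {((wordTerm u (.var i), wordTerm v (.var j)) : Identity n m)})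
    (hx : act w x = x) :
    i = j ∧ (w.map γ).prod ∈ Subgroup.zpowers ((u.map γ).prod⁻¹ * (v.map γ).prod) := by
  obtain ⟨t, rfl⟩ : ∃ t, classOf T _ t = x := Quotient.exists_rep x
  obtain ⟨r, c, rfl⟩ := exists_eq_wordTerm t
  have hij : i = j := by
    by_contra hij
    -- Send `a_i` to `u⁻¹` and `a_j` to `v⁻¹` in `G`: both sides of the relation become 1, while `G`
    -- acts on itself freely.
    have := hγ.smul_eq_of_follows hT hinf hx G
      (Function.update (Function.update (fun _ => 1) i (u.map γ).prod⁻¹) j (v.map γ).prod⁻¹) (by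
        rintro p rfl
        simp [realize_wordTerm, act_actionStructure, Function.update_of_ne hij])
    rw [smul_eq_mul, mul_eq_right] at this
    exact hw this
  subst hij
  refine ⟨rfl, ?_⟩
  set g := (u.map γ).prod⁻¹ * (v.map γ).prod with hg
  -- Send all generators to the identity coset of `⟨u⁻¹v⟩`; the relation holds, and by commutativity
  -- only elements of this subgroup fix a coset.
  have := hγ.smul_eq_of_follows hT hinf hx (G ⧸ Subgroup.zpowers g) (fun _ => ((1 : G) : G ⧸ _)) (by
    rintro p rfl
    simp only [realize_wordTerm, Term.realize_var]
    rw [act_actionStructure, act_actionStructure]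
    refine (QuotientGroup.eq (s := Subgroup.zpowers g)).2 ?_
    simp [g])
  have := (QuotientGroup.eq (s := Subgroup.zpowers g)).1 this
  simp only [smul_eq_mul, mul_one, mul_inv_rev] at this
  rw [mul_right_comm, inv_mul_cancel, one_mul] at this
  simpa using this

end IsWordGroup

end FixedPoints

/-! ### Counting exceptional identities -/

section Counting

variable {n m : ℕ} {G : Type} [CommGroup G] (γ : Fin n → G)

/-- Identities `u(a_i) = v(a_i)` such that the group element `u⁻¹ v` belongs to `B`. -/
def identitiesOver (m : ℕ) (B : Set G) : Set (Identity n m) :=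
  {p | ∃ (u v : List (Fin n)) (i : Fin m), p = (wordTerm u (.var i), wordTerm v (.var i)) ∧
    (u.map γ).prod⁻¹ * (v.map γ).prod ∈ B}

theorem swap_mem_identitiesOver {B : Set G} {p : Identity n m} (hp : p ∈ identitiesOver γ m B) :
    p.swap ∈ identitiesOver γ m B⁻¹ := by
  obtain ⟨u, v, i, rfl, h⟩ := hp
  exact ⟨v, u, i, rfl, by simpa using h⟩

theorem card_le_mul_card_of_fiber {α β : Type} [DecidableEq β] (f : α → β) (S I : Finset α)
    (c : ℝ) (h : ∀ b, ((S.filter (f · = b)).card : ℝ) ≤ c * (I.filter (f · = b)).card) :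
    (S.card : ℝ) ≤ c * I.card := by
  rw [Finset.card_eq_sum_card_fiberwise (f := f) (s := S) (t := S.image f ∪ I.image f)
      fun x hx => Finset.mem_coe.2 (Finset.mem_union_left _ (Finset.mem_image_of_mem f hx)),
    Finset.card_eq_sum_card_fiberwise (f := f) (s := I) (t := S.image f ∪ I.image f)
      fun x hx => Finset.mem_coe.2 (Finset.mem_union_right _ (Finset.mem_image_of_mem f hx))]
  push_cast
  rw [Finset.mul_sum]
  exact Finset.sum_le_sum fun b _ => h b

theorem mem_identitiesUpTo {s : ℕ} {p : Identity n m} :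
    p ∈ (finite_identitiesUpTo n m s).toFinset ↔ termLength p.1 + termLength p.2 ≤ s :=
  Set.Finite.mem_toFinset _

theorem prod_map_ofFn {l : ℕ} (w : Fin l → Fin n) :
    ((List.ofFn w).map γ).prod = ∏ j, γ (w j) := by
  rw [List.map_ofFn, List.prod_ofFn]
  rfl

open Classical in
-- Fix the left side `u(a_i)` and the length `l ≥ K` of the right side. If the fibre contains an
-- exceptional identity, it contains at least `n ^ l` identities in all, while the exceptional ones
-- have right sides with product in `uB`, at most `|B| δ n ^ l` of them.
theorem card_long_right_le {B : Set G} (hB : B.Finite) {K : ℕ} {δ : ℝ} (hδ : 0 ≤ δ)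
    (hK : ∀ k, K ≤ k → ∀ g, (numWords γ k g : ℝ) ≤ δ * (n : ℝ) ^ k) (s : ℕ) :
    (((finite_identitiesUpTo n m s).toFinset.filter fun p =>
      p ∈ identitiesOver γ m B ∧ K ≤ termLength p.2).card : ℝ) ≤
    (hB.toFinset.card * δ) * (finite_identitiesUpTo n m s).toFinset.card := by
  refine card_le_mul_card_of_fiber (fun p => (p.1, termLength p.2)) _ _ _ fun b => ?_
  obtain ⟨t, l⟩ := b
  obtain ⟨u, i, rfl⟩ := exists_eq_wordTerm t
  rw [Finset.filter_filter]
  rcases Finset.eq_empty_or_nonempty ((finite_identitiesUpTo n m s).toFinset.filter fun p =>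
    (p ∈ identitiesOver γ m B ∧ K ≤ termLength p.2) ∧
      (p.1, termLength p.2) = (wordTerm u (.var i), l)) with h | ⟨p, hp⟩
  · rw [h, Finset.card_empty, Nat.cast_zero]
    positivity
  · obtain ⟨hps, ⟨-, hKl⟩, hp⟩ := Finset.mem_filter.1 hp
    obtain ⟨hp₁, rfl⟩ := Prod.mk.inj hp
    rw [mem_identitiesUpTo, hp₁] at hps
    set l := termLength p.2
    let f : (Fin l → Fin n) → Identity n m :=
      fun w => (wordTerm u (.var i), wordTerm (List.ofFn w) (.var i))
    have hf : Function.Injective f := fun w w' h =>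
      List.ofFn_injective (wordTerm_injective (congrArg Prod.snd h)).1
    have hlower : n ^ l ≤ ((finite_identitiesUpTo n m s).toFinset.filter fun p =>
        (p.1, termLength p.2) = (wordTerm u (.var i), l)).card := by
      have : n ^ l = (Finset.univ.image f).card := by
        rw [Finset.card_image_of_injective _ hf]
        simp
      rw [this]
      refine Finset.card_le_card fun q hq => ?_
      obtain ⟨w, -, rfl⟩ := Finset.mem_image.1 hq
      have hw : termLength (f w).2 = l := by
        rw [termLength_wordTerm, List.length_ofFn]
      refine Finset.mem_filter.2 ⟨mem_identitiesUpTo.2 ?_, ?_⟩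
      · rw [hw]
        exact hps
      · rw [hw]
    have hupper : (((finite_identitiesUpTo n m s).toFinset.filter fun p =>
        (p ∈ identitiesOver γ m B ∧ K ≤ termLength p.2) ∧
          (p.1, termLength p.2) = (wordTerm u (.var i), l)).card : ℝ) ≤
        hB.toFinset.card * (δ * (n : ℝ) ^ l) := by
      have hsub : ((finite_identitiesUpTo n m s).toFinset.filter fun p =>
          (p ∈ identitiesOver γ m B ∧ K ≤ termLength p.2) ∧
            (p.1, termLength p.2) = (wordTerm u (.var i), l)) ⊆
          hB.toFinset.biUnion fun b =>
            (Finset.univ.filter fun w : Fin l → Fin n =>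
              ∏ j, γ (w j) = (u.map γ).prod * b).image f := by
        intro q hq
        obtain ⟨-, ⟨⟨u', v, i', rfl, hb⟩, -⟩, hq⟩ := Finset.mem_filter.1 hq
        obtain ⟨hq₁, hq₂⟩ := Prod.mk.inj hq
        obtain ⟨rfl, rfl⟩ := wordTerm_injective hq₁
        rw [termLength_wordTerm] at hq₂
        refine Finset.mem_biUnion.2 ⟨_, hB.mem_toFinset.2 hb, Finset.mem_image.2 ?_⟩
        obtain ⟨w, hw⟩ : ∃ w : Fin l → Fin n, List.ofFn w = v := by
          rw [← hq₂]
          exact ⟨v.get, List.ofFn_get v⟩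
        subst hw
        refine ⟨w, Finset.mem_filter.2 ⟨Finset.mem_univ _, ?_⟩, rfl⟩
        rw [mul_inv_cancel_left, prod_map_ofFn]
      refine (Nat.cast_le.2 ((Finset.card_le_card hsub).trans Finset.card_biUnion_le)).trans ?_
      rw [Nat.cast_sum, ← nsmul_eq_mul]
      refine Finset.sum_le_card_nsmul _ _ _ fun b _ => ?_
      exact (Nat.cast_le.2 Finset.card_image_le).trans (hK l hKl _)
    refine hupper.trans ?_
    rw [← mul_assoc]
    refine mul_le_mul_of_nonneg_left ?_ (by positivity)
    exact_mod_cast hlower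

open Classical in
theorem exists_card_identitiesOver_le [Infinite G]
    (hγ : ∀ g, ∃ w : List (Fin n), (w.map γ).prod = g) {B : Set G} (hB : B.Finite) {ε : ℝ}
    (hε : 0 < ε) : ∃ C : ℕ, ∀ s, (((finite_identitiesUpTo n m s).toFinset.filter fun p =>
      p ∈ identitiesOver γ m B).card : ℝ) ≤ C + ε * numPresentations n m s := by
  -- Long left and long right sides may each contribute `ε / 2`; the `+ 1` keeps the denominator
  -- positive when `B` is empty.
  set δ : ℝ := ε / (2 * (hB.toFinset.card + 1)) with hδ
  have hδ0 : 0 < δ := by positivity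
  have hBδ : ∀ {B' : Set G} (hB' : B'.Finite), B'.ncard = B.ncard →
      hB'.toFinset.card * δ ≤ ε / 2 := by
    intro B' hB' h
    rw [← Set.ncard_eq_toFinset_card _ hB', h, Set.ncard_eq_toFinset_card _ hB]
    have : ε / 2 = (hB.toFinset.card + 1) * δ := by rw [hδ]; field_simp
    rw [this]
    gcongr
    linarith
  obtain ⟨K, hK⟩ := exists_numWords_le hγ hδ0
  simp only [Fintype.card_fin] at hK
  refine ⟨(finite_identitiesUpTo n m (2 * K)).toFinset.card, fun s => ?_⟩
  set I := (finite_identitiesUpTo n m s).toFinset with hI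
  have hP : (numPresentations n m s : ℝ) = I.card := by
    rw [numPresentations, Set.ncard_eq_toFinset_card _ (finite_identitiesUpTo n m s)]
  have hright := card_long_right_le γ (m := m) hB hδ0.le hK s
  -- Swapping the sides replaces `B` by `B⁻¹`, of the same size.
  have hleft : ((I.filter fun p => p ∈ identitiesOver γ m B ∧ K ≤ termLength p.1).card : ℝ) ≤
      (hB.inv.toFinset.card * δ) * I.card := by
    refine (Nat.cast_le.2 (Finset.card_le_card_of_injOn Prod.swap ?_
      Prod.swap_injective.injOn)).trans (card_long_right_le γ (m := m) hB.inv hδ0.le hK s)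
    intro p hp
    obtain ⟨hpI, hpB, hpK⟩ := Finset.mem_filter.1 (Finset.mem_coe.1 hp)
    refine Finset.mem_coe.2 (Finset.mem_filter.2
      ⟨mem_identitiesUpTo.2 ?_, swap_mem_identitiesOver γ hpB, hpK⟩)
    rw [hI, mem_identitiesUpTo] at hpI
    simpa [add_comm] using hpI
  have hcover : (I.filter fun p => p ∈ identitiesOver γ m B) ⊆
      (finite_identitiesUpTo n m (2 * K)).toFinset ∪
        ((I.filter fun p => p ∈ identitiesOver γ m B ∧ K ≤ termLength p.1) ∪
          (I.filter fun p => p ∈ identitiesOver γ m B ∧ K ≤ termLength p.2)) := by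
    intro p hp
    obtain ⟨hpI, hpB⟩ := Finset.mem_filter.1 hp
    by_cases h₁ : K ≤ termLength p.1
    · exact Finset.mem_union_right _ (Finset.mem_union_left _
        (Finset.mem_filter.2 ⟨hpI, hpB, h₁⟩))
    by_cases h₂ : K ≤ termLength p.2
    · exact Finset.mem_union_right _ (Finset.mem_union_right _
        (Finset.mem_filter.2 ⟨hpI, hpB, h₂⟩))
    exact Finset.mem_union_left _ (mem_identitiesUpTo.2 (by omega))
  have hcard := (Finset.card_le_card hcover).trans ((Finset.card_union_le _ _).trans
    (Nat.add_le_add_left (Finset.card_union_le _ _) _))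
  have hcard' := (Nat.cast_le (α := ℝ)).2 hcard
  push_cast at hcard'
  have h₁ := mul_le_mul_of_nonneg_right (hBδ hB rfl) (Nat.cast_nonneg (α := ℝ) I.card)
  have h₂ := mul_le_mul_of_nonneg_right (hBδ hB.inv (Set.ncard_inv B))
    (Nat.cast_nonneg (α := ℝ) I.card)
  rw [hP]
  linarith

theorem le_numPresentations (hn : 0 < n) (hm : 0 < m) (s : ℕ) : s ≤ numPresentations n m s := by
  have h : ((fun k => (wordTerm (List.replicate k ⟨0, hn⟩) (.var ⟨0, hm⟩), .var ⟨0, hm⟩) :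
      ℕ → Identity n m) '' (Finset.range s : Set ℕ)) ⊆ identitiesUpTo n m s := by
    rintro _ ⟨k, hk, rfl⟩
    change termLength _ + 0 ≤ s
    rw [termLength_wordTerm, List.length_replicate]
    exact (Finset.mem_range.1 hk).le
  refine le_trans (le_of_eq ?_) (Set.ncard_le_ncard h (finite_identitiesUpTo n m s))
  rw [Set.ncard_image_of_injective, Set.ncard_coe_finset, Finset.card_range]
  intro k k' hkk
  have := (wordTerm_injective (congrArg Prod.fst hkk)).1
  simpa using congrArg List.length this

theorem tendsto_numPresentations (hn : 0 < n) (hm : 0 < m) :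
    Filter.Tendsto (fun s => (numPresentations n m s : ℝ)) Filter.atTop Filter.atTop :=
  Filter.tendsto_atTop_mono (fun s => Nat.cast_le.2 (le_numPresentations hn hm s))
    tendsto_natCast_atTop_atTop

open Classical in
theorem hasLimitingDensity_one {T : (unaryLang n).Theory} [Infinite G] (hn : 0 < n) (hm : 0 < m)
    (hγ : ∀ g, ∃ w : List (Fin n), (w.map γ).prod = g) {B : Set G} (hB : B.Finite)
    (φ : (unaryLang n).Sentence)
    (h : ∀ p : Identity n m, ¬ Presented T {p} ⊨ φ → p ∈ identitiesOver γ m B) :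
    HasLimitingDensity T m φ 1 := by
  rw [HasLimitingDensity, Metric.tendsto_atTop']
  intro ε hε
  obtain ⟨C, hC⟩ := exists_card_identitiesOver_le (m := m) γ hγ hB (half_pos hε)
  obtain ⟨s₀, hs₀⟩ := Filter.eventually_atTop.1
    ((tendsto_numPresentations hn hm).eventually_gt_atTop (C / (ε / 2)))
  refine ⟨s₀, fun s hs => ?_⟩
  have hPC := hs₀ s hs.le
  have hP : (0 : ℝ) < numPresentations n m s := lt_of_le_of_lt (by positivity) hPC
  rw [div_lt_iff₀ (half_pos hε)] at hPC
  have hle : numPresentationsSat T m φ s ≤ numPresentations n m s :=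
    Set.ncard_le_ncard (Set.sep_subset _ _) (finite_identitiesUpTo n m s)
  have hge : numPresentations n m s ≤ numPresentationsSat T m φ s +
      ((finite_identitiesUpTo n m s).toFinset.filter fun p => p ∈ identitiesOver γ m B).card := by
    rw [← Set.ncard_coe_finset]
    refine le_trans (Set.ncard_le_ncard (fun p hp => ?_)
      (((finite_identitiesUpTo n m s).subset (Set.sep_subset _ _)).union (Finset.finite_toSet _)))
      (Set.ncard_union_le _ _)
    by_cases hφ : Presented T {p} ⊨ φ
    · exact Or.inl ⟨hp, hφ⟩
    · exact Or.inr (Finset.mem_coe.2 (Finset.mem_filter.2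
        ⟨(Set.Finite.mem_toFinset _).2 hp, h p hφ⟩))
  have hle' : (numPresentationsSat T m φ s : ℝ) ≤ numPresentations n m s := Nat.cast_le.2 hle
  have hge' := (Nat.cast_le (α := ℝ)).2 hge
  push_cast at hge'
  have hCs := hC s
  rw [Real.dist_eq, div_sub_one hP.ne', abs_div, abs_of_pos hP, div_lt_iff₀ hP, abs_lt]
  constructor <;> nlinarith

end Counting
end UnaryVariety

/-! ### Assembly of the theorem -/

theorem mainTheorem3 (n m : ℕ) (hm : 1 ≤ m) (T : (unaryLang n).Theory)
    (hT : IsEquational T) (hbij : IsGeneralizedBijective T) (hcomm : IsCommutative T)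
    (hinf : Infinite (Free T 1)) :
    (∀ φ : (unaryLang n).Sentence, Free T m ⊨ φ → HasLimitingDensity T m φ 1) ∧
      (Free T m ≅[unaryLang n] Free T 1) := by
  obtain ⟨G, _, γ, hγ⟩ := exists_isWordGroup hT hbij hcomm
  have := hγ.infinite hinf
  have := hγ.fg
  have hne : ∀ R : Set (Identity n m), Nonempty (Presented T R) :=
    fun R => ⟨classOf T R (.var ⟨0, hm⟩)⟩
  have := hne ∅
  have hm' : Free T m ⊨ freeTheory T γ := hγ.free_models hT hinf
  have h1 : Free T 1 ⊨ freeTheory T γ := hγ.free_models hT hinf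
  refine ⟨fun φ hφ => ?_, (hγ.isComplete hm').models_elementarily_equivalent _ _⟩
  -- Without function symbols the only word is empty and `G` would be trivial.
  have hn : 0 < n := by
    rcases Nat.eq_zero_or_pos n with rfl | hn
    · refine absurd ‹Infinite G› (not_infinite_iff_finite.2 ?_)
      have : Function.Surjective fun w : List (Fin 0) => (w.map γ).prod := hγ.exists_word
      exact Finite.of_surjective _ this
    · exact hn
  obtain ⟨E, hE, hEφ⟩ := hγ.exists_finite_words hm' φ hφ
  -- The set `B` of all roots of the finitely many elements that must act without fixed points.
  have hB : (⋃ w ∈ E, {g : G | (w.map γ).prod ∈ Subgroup.zpowers g}).Finite :=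
    E.finite_toSet.biUnion fun w hw => finite_setOf_mem_zpowers (hE w hw)
  refine hasLimitingDensity_one γ hn hm hγ.exists_word hB φ fun p hp => ?_
  obtain ⟨t, t'⟩ := p
  obtain ⟨u, i, rfl⟩ := exists_eq_wordTerm t
  obtain ⟨v, j, rfl⟩ := exists_eq_wordTerm t'
  have := hne {((wordTerm u (.var i), wordTerm v (.var j)) : Identity n m)}
  have := presented_models T {((wordTerm u (.var i), wordTerm v (.var j)) : Identity n m)} hT
  have hfix : ∃ w ∈ E, ∃ x : Presented T {((wordTerm u (.var i), wordTerm v (.var j)) :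
      Identity n m)}, act w x = x := by
    by_contra h
    push Not at h
    exact hp (hEφ _ h)
  obtain ⟨w, hw, x, hx⟩ := hfix
  obtain ⟨rfl, hmem⟩ := hγ.eq_and_mem_zpowers hT hinf (hE w hw) x hx
  exact ⟨u, v, i, rfl, Set.mem_biUnion (Finset.mem_coe.2 hw) hmem⟩
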